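/- For points $x_1,\dots,x_n$ in the unit square $[0,1]^2$ (repetitions allowed), $n\ge 1$, let $$C_n(x_1,\dots,x_n)=\min_{F}\Big(|F|+\sum_{i=1}^n\min_{f\in F}\|x_i-f\|\Big),$$ where $F$ ranges over the nonempty finite subsets of $[0,1]^2$ and $\|\cdot\|$ is the Euclidean norm. **Theorem (Weak Concentration).** There are absolute constants $K,A>0$ and a function $L:(0,\infty)\to\mathbb{R}$ such that the following holds for every $n\ge 1$ and all independent (not necessarily uniform, not necessarily identically distributed) random points $X_1,\dots,X_n$ in $[0,1]^2$. Let $C_n=C_n(X_1,\dots,X_n)$ and let $\mathrm{Med}(C_n)$ be any median of $C_n$. Then 1. for every $t\ge 0$, $$\Pr\big(|C_n-\mathrm{Med}(C_n)|\ge t\big)\le 2\exp\!\Big(-\frac{t^2}{K n^{2/3}}\Big);$$ 2. for every $t\ge A n^{1/3}$, $$\Pr\big(|C_n-\mathrm{Med}(C_n)|\ge t\big)\le \exp\!\Big(-\frac{t^2}{K n^{2/3}}\Big);$$ 3. $C_n$ is concentrated in a window of length $O(n^{1/3})$: for every $\varepsilon>0$, $$\Pr\big(|C_n-\mathrm{Med}(C_n)|\le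 L(\varepsilon)\, n^{1/3}\big)\ge 1-\varepsilon .$$ -/

import Mathlib

open MeasureTheory ProbabilityTheory

universe u

/-- The Euclidean plane. -/
abbrev Plane : Type := EuclideanSpace ℝ (Fin 2)

/-- The unit square `[0,1]²`. -/
def unitSquare : Set Plane := {x | ∀ j, x j ∈ Set.Icc (0 : ℝ) 1}

/-- The facility location objective of the facility set `F` for the points `X 1, …, X n`: one unit
per facility, plus the Euclidean distance of each point (with multiplicity) to its nearest
facility. -/
noncomputable def facilityObjective {n : ℕ} (X : Fin n → Plane) (F : Finset Plane)
    (hF : F.Nonempty) : ℝ :=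
  (F.card : ℝ) + ∑ i, F.inf' hF (fun f => ‖X i - f‖)

/-- The facility location cost `C_n(X)`: the least objective over all nonempty finite sets of
facilities in the unit square (an infinite set of facilities has infinite cost). -/
noncomputable def facilityCost {n : ℕ} (X : Fin n → Plane) : ℝ :=
  sInf {c : ℝ | ∃ (F : Finset Plane) (hF : F.Nonempty),
    (F : Set Plane) ⊆ unitSquare ∧ c = facilityObjective X F hF}

/-- `m` is a median of the real random variable `Y` under the probability measure `P`. -/
def IsMedian {Ω : Type u} [MeasurableSpace Ω] (P : Measure Ω) (Y : Ω → ℝ) (m : ℝ) : Prop :=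
  1 / 2 ≤ P.real {ω | Y ω ≤ m} ∧ 1 / 2 ≤ P.real {ω | m ≤ Y ω}

/-!
The proof combines a stability estimate for the facility location cost with Talagrand's convex
distance inequality.

Stability. Divide the square into cells of diameter at most `δ`, and let `k i` be the number of
the points of `x` that share the cell of `x i`. Then for every `y`
`C(x) ≤ C(y) + ∑ i with y i ≠ x i, (2 δ + 4 / k i)`
(`facilityCost_le_add_sum_ne`). To see this, take an optimal solution for `y`. Where at least half
of the points of a cell have been changed, open one more facility there; its cost is shared by the
at least `k / 2` changed points. In any other cell at least `k / 2` points are unchanged, and since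
opening a facility in that cell does not improve the solution for `y`, one of them is at distance at
most `δ + O(1 / k)` from the facilities; the changed points are within `δ` of it. The weights
depend on `x` alone, and `∑ i, 1 / (k i) ^ 2` is at most the number of cells. With `δ` of order
`n ^ (-1 / 3)` the squares of the weights add up to at most `320 n ^ (2 / 3)`
(`exists_facilityCost_weights`).

Talagrand's inequality. Let `f` be a function on a product space such that
`f x ≤ f y + ∑ i with y i ≠ x i, a i`, where `a` depends on `x` and `∑ i, a i ^ 2 ≤ c`. Then
`E exp (l f) * E exp (-l f) ≤ exp (2 l ^ 2 c)` for `l ≥ 0` and independent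
coordinates. On finite spaces this follows from the functional form of Talagrand's inequality,
`E exp (Q h) * E exp (-h) ≤ 1`, in which `Q h` is an infimum convolution of `h` with a quadratic transport penalty
(`talagrand_functional`, by induction on the number of coordinates). Finite spaces raise no question
about the measurability of `Q h`; the case of general laws (`mgf_mul_mgf_neg_le`) is reached by
rounding the random points, since the cost is continuous.

Chernoff's bound then compares `f` with its median (`measureReal_le_abs_sub_median`).
-/

/-! ### Elementary properties of the facility location cost -/

/-- The distance from `p` to the nearest point of the nonempty finite set `F`. -/
noncomputable def nearestDist (F : Finset Plane) (hF : F.Nonempty) (p : Plane) : ℝ :=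
  F.inf' hF (fun f => ‖p - f‖)

theorem nearestDist_le {F : Finset Plane} (hF : F.Nonempty) (p : Plane) {f : Plane}
    (hf : f ∈ F) : nearestDist F hF p ≤ ‖p - f‖ :=
  Finset.inf'_le _ hf

theorem nearestDist_nonneg {F : Finset Plane} (hF : F.Nonempty) (p : Plane) :
    0 ≤ nearestDist F hF p :=
  Finset.le_inf' _ _ fun _ _ => norm_nonneg _

theorem nearestDist_anti {F G : Finset Plane} (hF : F.Nonempty) (hG : G.Nonempty) (h : F ⊆ G)
    (p : Plane) : nearestDist G hG p ≤ nearestDist F hF p :=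
  Finset.inf'_mono _ h hF

theorem nearestDist_le_add {F : Finset Plane} (hF : F.Nonempty) (p q : Plane) :
    nearestDist F hF p ≤ ‖p - q‖ + nearestDist F hF q := by
  obtain ⟨f, hf, hfq⟩ := Finset.exists_mem_eq_inf' hF (fun f => ‖q - f‖)
  have h1 := nearestDist_le hF p hf
  have h2 : nearestDist F hF q = ‖q - f‖ := hfq
  have h3 := norm_sub_le_norm_sub_add_norm_sub p q f
  linarith

theorem facilityObjective_eq {n : ℕ} (X : Fin n → Plane) (F : Finset Plane) (hF : F.Nonempty) :
    facilityObjective X F hF = F.card + ∑ i, nearestDist F hF (X i) := rfl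

theorem facilityObjective_nonneg {n : ℕ} (X : Fin n → Plane) (F : Finset Plane)
    (hF : F.Nonempty) : 0 ≤ facilityObjective X F hF := by
  rw [facilityObjective_eq]
  have := Finset.sum_nonneg fun i (_ : i ∈ Finset.univ) => nearestDist_nonneg hF (X i)
  positivity

theorem facilityCost_le {n : ℕ} (X : Fin n → Plane) (F : Finset Plane) (hF : F.Nonempty)
    (hU : (F : Set Plane) ⊆ unitSquare) : facilityCost X ≤ facilityObjective X F hF :=
  csInf_le ⟨0, by rintro c ⟨F, hF, -, rfl⟩; exact facilityObjective_nonneg X F hF⟩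
    ⟨F, hF, hU, rfl⟩

theorem zero_mem_unitSquare : (0 : Plane) ∈ unitSquare := by
  intro j
  simp

theorem exists_facilityObjective_lt {n : ℕ} (X : Fin n → Plane) {c : ℝ}
    (hc : facilityCost X < c) :
    ∃ (F : Finset Plane) (hF : F.Nonempty), (F : Set Plane) ⊆ unitSquare ∧
      facilityObjective X F hF < c := by
  have hne : {c : ℝ | ∃ (F : Finset Plane) (hF : F.Nonempty),
      (F : Set Plane) ⊆ unitSquare ∧ c = facilityObjective X F hF}.Nonempty :=
    ⟨_, {0}, Finset.singleton_nonempty _, by simpa using zero_mem_unitSquare, rfl⟩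
  obtain ⟨_, ⟨F, hF, hU, rfl⟩, h⟩ := exists_lt_of_csInf_lt hne hc
  exact ⟨F, hF, hU, h⟩

theorem facilityCost_nonneg {n : ℕ} (X : Fin n → Plane) : 0 ≤ facilityCost X :=
  Real.sInf_nonneg (by rintro c ⟨F, hF, -, rfl⟩; exact facilityObjective_nonneg X F hF)

theorem facilityCost_le_add_sum_norm {n : ℕ} (x y : Fin n → Plane) :
    facilityCost x ≤ facilityCost y + ∑ i, ‖x i - y i‖ := by
  refine le_of_forall_pos_le_add fun ε hε => ?_
  obtain ⟨F, hF, hU, h⟩ := exists_facilityObjective_lt y (lt_add_of_pos_right (facilityCost y) hε)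
  have h1 := facilityCost_le x F hF hU
  rw [facilityObjective_eq] at h h1
  have h2 := Finset.sum_le_sum fun i (_ : i ∈ Finset.univ) => nearestDist_le_add hF (x i) (y i)
  rw [Finset.sum_add_distrib] at h2
  linarith

theorem continuous_facilityCost {n : ℕ} :
    Continuous (facilityCost : (Fin n → Plane) → ℝ) := by
  rw [continuous_iff_continuousAt]
  intro y
  have hs : Filter.Tendsto (fun x : Fin n → Plane => ∑ i, ‖x i - y i‖) (nhds y) (nhds 0) := by
    have : Continuous fun x : Fin n → Plane => ∑ i, ‖x i - y i‖ := by fun_prop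
    simpa using this.tendsto y
  refine tendsto_iff_dist_tendsto_zero.2 (squeeze_zero (fun _ => dist_nonneg) (fun x => ?_) hs)
  rw [Real.dist_eq, abs_le]
  have h1 := facilityCost_le_add_sum_norm x y
  have h2 := facilityCost_le_add_sum_norm y x
  simp_rw [norm_sub_rev (y _) (x _)] at h2
  constructor <;> linarith

theorem norm_sub_le_of_coord {p q : Plane} {d : ℝ} (h : ∀ j, |p j - q j| ≤ d) :
    ‖p - q‖ ≤ 2 * d := by
  have hd : 0 ≤ d := (abs_nonneg _).trans (h 0)
  rw [EuclideanSpace.norm_eq, Real.sqrt_le_left (by positivity), Fin.sum_univ_two]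
  have h0 := pow_le_pow_left₀ (abs_nonneg _) (h 0) 2
  have h1 := pow_le_pow_left₀ (abs_nonneg _) (h 1) 2
  simp only [PiLp.sub_apply, Real.norm_eq_abs]
  nlinarith [sq_nonneg d]

theorem facilityCost_le_of_mem {n : ℕ} {X : Fin n → Plane} (hX : ∀ i, X i ∈ unitSquare) :
    facilityCost X ≤ 1 + 2 * n := by
  refine (facilityCost_le X {0} (Finset.singleton_nonempty _)
    (by simpa using zero_mem_unitSquare)).trans ?_
  rw [facilityObjective_eq]
  have : ∀ i ∈ Finset.univ, nearestDist {0} (Finset.singleton_nonempty _) (X i) ≤ 2 := fun i _ =>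
    (nearestDist_le _ _ (Finset.mem_singleton_self _)).trans <| by
      have := norm_sub_le_of_coord (p := X i) (q := 0) (d := 1) fun j => by
        have := hX i j
        simp only [PiLp.zero_apply, sub_zero]
        exact abs_le.2 ⟨by linarith [this.1], this.2⟩
      linarith
  have := Finset.sum_le_card_nsmul _ _ _ this
  simp only [Finset.card_univ, Fintype.card_fin, nsmul_eq_mul, Finset.card_singleton,
    Nat.cast_one] at this ⊢
  linarith

/-! ### Stability of the cost -/

/-- The number of the points `x 1, …, x n` that lie in the same cell as `x i`. -/
noncomputable def cellCount {n : ℕ} {C : Type*} [DecidableEq C] (cell : Plane → C)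
    (x : Fin n → Plane) (i : Fin n) : ℕ :=
  (Finset.univ.filter fun j => cell (x j) = cell (x i)).card

theorem cellCount_pos {n : ℕ} {C : Type*} [DecidableEq C] (cell : Plane → C)
    (x : Fin n → Plane) (i : Fin n) : 0 < cellCount cell x i :=
  Finset.card_pos.2 ⟨i, by simp⟩

/-- In a nearly optimal solution, points that lie near a common point `p` of the square have small
total distance to the facilities, since one could open a facility at `p`. -/
theorem sum_nearestDist_le {n : ℕ} {y : Fin n → Plane} {F : Finset Plane} {hF : F.Nonempty}
    (hU : (F : Set Plane) ⊆ unitSquare) {ε δ : ℝ}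
    (hε : facilityObjective y F hF ≤ facilityCost y + ε) {p : Plane} (hp : p ∈ unitSquare)
    {G : Finset (Fin n)} (hG : ∀ j ∈ G, ‖y j - p‖ ≤ δ) :
    ∑ j ∈ G, nearestDist F hF (y j) ≤ 1 + ε + G.card * δ := by
  classical
  have hF' : (insert p F).Nonempty := Finset.insert_nonempty _ _
  have h1 := facilityCost_le y (insert p F) hF' (by
    rw [Finset.coe_insert]; exact Set.insert_subset hp hU)
  rw [facilityObjective_eq] at h1 hε
  have hc : ((insert p F).card : ℝ) ≤ F.card + 1 := by exact_mod_cast Finset.card_insert_le _ _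
  rw [← Finset.sum_add_sum_compl G] at h1 hε
  have h2 : ∑ j ∈ Gᶜ, nearestDist (insert p F) hF' (y j) ≤ ∑ j ∈ Gᶜ, nearestDist F hF (y j) :=
    Finset.sum_le_sum fun j _ => nearestDist_anti hF hF' (Finset.subset_insert _ _) _
  have h3 : ∑ j ∈ G, nearestDist (insert p F) hF' (y j) ≤ G.card * δ := by
    rw [← nsmul_eq_mul]
    exact Finset.sum_le_card_nsmul _ _ _ fun j hj =>
      (nearestDist_le hF' _ (Finset.mem_insert_self _ _)).trans (hG j hj)
  linarith

/-- The stability of the facility location cost. The weights on the right depend on `x` alone,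
which is what Talagrand's inequality asks for. Starting from a nearly optimal solution for `y`, a
facility is added in each cell where at least half of the points of `x` have been changed; in any
other cell the changed points go along with the unchanged ones, whose distance to the facilities is
at most of the order of the inverse of their number. -/
theorem facilityCost_le_add_sum_ne {n : ℕ} {C : Type*} [DecidableEq C] (cell : Plane → C)
    {δ : ℝ} (hδ0 : 0 ≤ δ)
    (hδ : ∀ p ∈ unitSquare, ∀ q ∈ unitSquare, cell p = cell q → ‖p - q‖ ≤ δ)
    {x : Fin n → Plane} (hx : ∀ i, x i ∈ unitSquare) (y : Fin n → Plane) :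
    facilityCost x ≤ facilityCost y +
      ∑ i, if y i ≠ x i then 2 * δ + 4 / (cellCount cell x i : ℝ) else 0 := by
  classical
  suffices H : ∀ ε : ℝ, 0 < ε → ε ≤ 1 → facilityCost x ≤ facilityCost y +
      (∑ i, if y i ≠ x i then 2 * δ + 4 / (cellCount cell x i : ℝ) else 0) + ε by
    refine le_of_forall_pos_le_add fun ε hε => ?_
    have := H (min ε 1) (by positivity) (min_le_right _ _)
    linarith [min_le_left ε 1]
  intro ε hε hε1
  obtain ⟨F, hF, hU, hobj⟩ :=
    exists_facilityObjective_lt y (lt_add_of_pos_right (facilityCost y) hε)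
  let N : C → Finset (Fin n) := fun q => Finset.univ.filter fun j => cell (x j) = q
  let B : C → Finset (Fin n) := fun q => (N q).filter fun j => y j ≠ x j
  let G : C → Finset (Fin n) := fun q => (N q).filter fun j => ¬ y j ≠ x j
  have hBG : ∀ q, (B q).card + (G q).card = (N q).card := fun q =>
    Finset.card_filter_add_card_filter_not _
  -- The cells in which at least half of the points have been changed.
  let T : Finset C := (Finset.univ.image fun j => cell (x j)).filter
    fun q => (N q).card ≤ 2 * (B q).card
  have hrep : ∀ q ∈ T, ∃ p ∈ unitSquare, cell p = q := by
    intro q hq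
    obtain ⟨j, -, rfl⟩ := Finset.mem_image.1 (Finset.mem_filter.1 hq).1
    exact ⟨x j, hx j, rfl⟩
  choose! r hrU hrc using hrep
  let F' : Finset Plane := F ∪ T.image r
  have hF' : F'.Nonempty := hF.mono Finset.subset_union_left
  have hU' : (F' : Set Plane) ⊆ unitSquare := by
    intro p hp
    rcases Finset.mem_union.1 (Finset.mem_coe.1 hp) with h | h
    · exact hU h
    · obtain ⟨q, hq, rfl⟩ := Finset.mem_image.1 h
      exact hrU q hq
  have hcard : (F'.card : ℝ) ≤ F.card + T.card := by
    exact_mod_cast (Finset.card_union_le _ _).trans (Nat.add_le_add_left Finset.card_image_le _)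
  -- The new facilities are paid for by the changed points of their cells.
  have hT : (T.card : ℝ) ≤ ∑ i, if y i ≠ x i ∧ cell (x i) ∈ T then
      2 / (cellCount cell x i : ℝ) else 0 := by
    rw [← Finset.sum_filter, ← Finset.sum_fiberwise_of_maps_to (t := T)
      (g := fun i => cell (x i)) (fun i hi => (Finset.mem_filter.1 hi).2.2),
      Finset.card_eq_sum_ones, Nat.cast_sum]
    refine Finset.sum_le_sum fun q hq => ?_
    have hBq : ((Finset.univ.filter fun i => y i ≠ x i ∧ cell (x i) ∈ T).filter
        fun i => cell (x i) = q) = B q := by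
      ext i
      simp only [B, N, Finset.mem_filter, Finset.mem_univ, true_and]
      constructor
      · rintro ⟨⟨h1, -⟩, h2⟩; exact ⟨h2, h1⟩
      · rintro ⟨h2, h1⟩; exact ⟨⟨h1, h2 ▸ hq⟩, h2⟩
    rw [hBq, Finset.sum_congr rfl (g := fun _ => 2 / ((N q).card : ℝ)) (fun i hi => by
      have : cell (x i) = q := by
        have := (Finset.mem_filter.1 hi).1
        simpa [N] using this
      simp only [cellCount, N, this]), Finset.sum_const, nsmul_eq_mul]
    obtain ⟨hq1, hq2⟩ := Finset.mem_filter.1 hq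
    obtain ⟨j, -, hj⟩ := Finset.mem_image.1 hq1
    have hpos : (0 : ℝ) < (N q).card := by
      exact_mod_cast Finset.card_pos.2 ⟨j, by simpa [N] using hj⟩
    have hq2' : ((N q).card : ℝ) ≤ 2 * (B q).card := by exact_mod_cast hq2
    rw [Nat.cast_one, mul_div_assoc', le_div_iff₀ hpos]
    linarith
  have hdist : ∀ i, nearestDist F' hF' (x i) ≤ nearestDist F hF (y i) +
      ((if y i ≠ x i then 2 * δ + 4 / (cellCount cell x i : ℝ) else 0) -
        if y i ≠ x i ∧ cell (x i) ∈ T then 2 / (cellCount cell x i : ℝ) else 0) := by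
    intro i
    have hk : (0 : ℝ) < cellCount cell x i := by exact_mod_cast cellCount_pos cell x i
    have hsub := nearestDist_anti hF hF' Finset.subset_union_left (x i)
    have hnn := nearestDist_nonneg hF (y i)
    by_cases hi : y i = x i
    · simp only [hi, ne_eq, not_true_eq_false, if_false, false_and, sub_zero, add_zero]
      exact hsub
    by_cases hq : cell (x i) ∈ T
    · simp only [hi, hq, ne_eq, not_false_eq_true, if_true, and_true]
      have h1 := nearestDist_le hF' (x i)
        (Finset.mem_union_right F (Finset.mem_image_of_mem r hq))
      have h2 := hδ _ (hx i) _ (hrU _ hq) (hrc _ hq).symm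
      have h3 : 2 / (cellCount cell x i : ℝ) ≤ 4 / (cellCount cell x i : ℝ) := by
        gcongr; norm_num
      linarith
    · simp only [hi, hq, ne_eq, not_false_eq_true, if_true, and_false, if_false, sub_zero]
      have hmaj : (N (cell (x i))).card ≤ 2 * (G (cell (x i))).card := by
        by_contra hcon
        refine hq (Finset.mem_filter.2 ⟨Finset.mem_image_of_mem _ (Finset.mem_univ i), ?_⟩)
        have := hBG (cell (x i))
        omega
      have hkN : ((N (cell (x i))).card : ℝ) = cellCount cell x i := rfl
      have hmaj' : (cellCount cell x i : ℝ) ≤ 2 * (G (cell (x i))).card := by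
        rw [← hkN]; exact_mod_cast hmaj
      have hGpos : (0 : ℝ) < (G (cell (x i))).card := by linarith
      have hGd : ∀ j ∈ G (cell (x i)), y j = x j ∧ ‖x j - x i‖ ≤ δ := by
        intro j hj
        simp only [G, N, Finset.mem_filter, Finset.mem_univ, true_and, not_not] at hj
        exact ⟨hj.2, hδ _ (hx j) _ (hx i) hj.1⟩
      have hsum := sum_nearestDist_le (ε := ε) (δ := δ) hU hobj.le (hx i)
        (G := G (cell (x i))) fun j hj => by rw [(hGd j hj).1]; exact (hGd j hj).2
      -- Some unchanged point of the cell is at most at the average distance.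
      obtain ⟨j, hj, hjle⟩ := Finset.exists_le_of_sum_le
        (s := G (cell (x i))) (f := fun j => nearestDist F hF (y j))
        (g := fun _ => 4 / (cellCount cell x i : ℝ) + δ)
        (Finset.card_pos.1 (by exact_mod_cast hGpos)) (by
          rw [Finset.sum_const, nsmul_eq_mul, mul_add]
          refine hsum.trans (add_le_add_left ?_ _)
          rw [mul_div_assoc', le_div_iff₀ hk]
          nlinarith)
      have h1 := nearestDist_le_add hF (x i) (x j)
      have h2 := (hGd j hj).2
      rw [norm_sub_rev] at h2
      simp only [(hGd j hj).1] at hjle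
      linarith
  have hfin := facilityCost_le x F' hF' hU'
  rw [facilityObjective_eq] at hfin hobj
  have hs := Finset.sum_le_sum fun i (_ : i ∈ Finset.univ) => hdist i
  rw [Finset.sum_add_distrib, Finset.sum_sub_distrib] at hs
  linarith

theorem sum_weight_sq_le {n : ℕ} {C : Type*} [DecidableEq C] [Fintype C] (cell : Plane → C) (δ : ℝ)
    (x : Fin n → Plane) :
    ∑ i, (2 * δ + 4 / (cellCount cell x i : ℝ)) ^ 2 ≤
      8 * δ ^ 2 * n + 32 * (Fintype.card C : ℝ) := by
  have h1 : ∑ i, (1 / (cellCount cell x i : ℝ)) ^ 2 ≤ (Fintype.card C : ℝ) := by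
    rw [← Finset.sum_fiberwise Finset.univ (fun i => cell (x i)),
      ← Finset.card_univ, Finset.card_eq_sum_ones, Nat.cast_sum]
    refine Finset.sum_le_sum fun q _ => ?_
    rw [Finset.sum_congr rfl (g := fun _ =>
      (1 / ((Finset.univ.filter fun j => cell (x j) = q).card : ℝ)) ^ 2) (fun i hi => by
        simp only [cellCount, (Finset.mem_filter.1 hi).2]), Finset.sum_const, nsmul_eq_mul]
    rcases Nat.eq_zero_or_pos (Finset.univ.filter fun j => cell (x j) = q).card with h | h
    · simp [h]
    · have h' : (1 : ℝ) ≤ (Finset.univ.filter fun j => cell (x j) = q).card := by exact_mod_cast h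
      rw [one_div, inv_pow, sq, mul_inv, ← mul_assoc, mul_inv_cancel₀ (by positivity), one_mul,
        Nat.cast_one]
      exact inv_le_one_of_one_le₀ h'
  calc ∑ i, (2 * δ + 4 / (cellCount cell x i : ℝ)) ^ 2
      ≤ ∑ i, (8 * δ ^ 2 + 32 * (1 / (cellCount cell x i : ℝ)) ^ 2) :=
        Finset.sum_le_sum fun i _ => by
          have : 4 / (cellCount cell x i : ℝ) = 4 * (1 / (cellCount cell x i : ℝ)) := by ring
          rw [this]
          nlinarith [sq_nonneg (2 * δ - 4 * (1 / (cellCount cell x i : ℝ)))]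
    _ = 8 * δ ^ 2 * n + 32 * ∑ i, (1 / (cellCount cell x i : ℝ)) ^ 2 := by
        rw [Finset.sum_add_distrib, Finset.mul_sum, Finset.sum_const, Finset.card_univ,
          Fintype.card_fin, nsmul_eq_mul, mul_comm (n : ℝ)]
    _ ≤ _ := by linarith

/-- The cell of side `1 / m` that contains `p`. The capping by `m` only affects points outside the
unit square. -/
noncomputable def gridCell (m : ℕ) (p : Plane) : Fin 2 → Fin (m + 1) :=
  fun j => ⟨min ⌊m * p j⌋₊ m, Nat.lt_succ_of_le (min_le_right _ _)⟩

theorem norm_sub_le_of_gridCell_eq {m : ℕ} (hm : 0 < m) {p q : Plane} (hp : p ∈ unitSquare)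
    (hq : q ∈ unitSquare) (h : gridCell m p = gridCell m q) : ‖p - q‖ ≤ 2 * (1 / m) := by
  refine norm_sub_le_of_coord fun j => ?_
  have hm' : (0 : ℝ) < m := by exact_mod_cast hm
  have key : ∀ a : ℝ, a ∈ Set.Icc (0 : ℝ) 1 → min ⌊m * a⌋₊ m = ⌊m * a⌋₊ := fun a ha =>
    min_eq_left (Nat.floor_le_of_le (by nlinarith [ha.2]))
  have hj : ⌊m * p j⌋₊ = ⌊m * q j⌋₊ := by
    have := congrArg Fin.val (congrFun h j)
    simpa only [gridCell, key _ (hp j), key _ (hq j)] using this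
  have hp1 := Nat.floor_le (mul_nonneg hm'.le (hp j).1)
  have hp2 := Nat.lt_floor_add_one (m * p j)
  have hq1 := Nat.floor_le (mul_nonneg hm'.le (hq j).1)
  have hq2 := Nat.lt_floor_add_one (m * q j)
  rw [hj] at hp1 hp2
  rw [le_div_iff₀ hm']
  calc |p j - q j| * m = |m * p j - m * q j| := by
        rw [← mul_sub, abs_mul, abs_of_pos hm', mul_comm]
    _ ≤ 1 := abs_le.2 ⟨by linarith, by linarith⟩

/-- With cells of side about `n ^ (-1 / 3)`, the squares of the weights in the stability estimate
add up to `O(n ^ (2 / 3))`. -/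
theorem exists_facilityCost_weights {n : ℕ} (hn : 1 ≤ n) {x : Fin n → Plane}
    (hx : ∀ i, x i ∈ unitSquare) :
    ∃ a : Fin n → ℝ, ∑ i, a i ^ 2 ≤ 320 * (n : ℝ) ^ (2 / 3 : ℝ) ∧
      ∀ y, facilityCost x ≤ facilityCost y + ∑ i, if y i ≠ x i then a i else 0 := by
  set z : ℝ := (n : ℝ) ^ (1 / 3 : ℝ) with hz
  have hn' : (1 : ℝ) ≤ n := by exact_mod_cast hn
  have hz1 : 1 ≤ z := Real.one_le_rpow hn' (by norm_num)
  have hz2 : (n : ℝ) ^ (2 / 3 : ℝ) = z ^ 2 := by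
    rw [hz, ← Real.rpow_natCast, ← Real.rpow_mul (by positivity)]; norm_num
  have hz3 : (n : ℝ) = z ^ 3 := by
    rw [hz, ← Real.rpow_natCast, ← Real.rpow_mul (by positivity)]; norm_num
  let m : ℕ := ⌈z⌉₊
  have hm : 0 < m := Nat.ceil_pos.2 (by linarith)
  have hzm : z ≤ m := Nat.le_ceil z
  have hmz : (m : ℝ) < z + 1 := Nat.ceil_lt_add_one (by linarith)
  refine ⟨fun i => 2 * (2 * (1 / m)) + 4 / (cellCount (gridCell m) x i : ℝ), ?_,
    facilityCost_le_add_sum_ne (gridCell m) (by positivity)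
      (fun p hp q hq h => norm_sub_le_of_gridCell_eq hm hp hq h) hx⟩
  refine (sum_weight_sq_le (gridCell m) _ x).trans ?_
  have hC : (Fintype.card (Fin 2 → Fin (m + 1)) : ℝ) ≤ 9 * z ^ 2 := by
    simp only [Fintype.card_pi, Fintype.card_fin, Finset.prod_const, Finset.card_univ]
    push_cast
    nlinarith
  have hinv : (1 / (m : ℝ)) ^ 2 * n ≤ z ^ 2 := by
    rw [hz3, div_pow, one_pow, div_mul_eq_mul_div, one_mul, div_le_iff₀ (by positivity)]
    have : z ^ 2 ≤ (m : ℝ) ^ 2 := by gcongr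
    calc z ^ 3 ≤ z ^ 2 * z ^ 2 := by nlinarith [pow_pos (by linarith : (0:ℝ) < z) 3]
      _ ≤ _ := by gcongr
  rw [hz2]
  nlinarith

/-! ### Talagrand's inequality on finite product spaces -/

section Talagrand

variable {S : Type*} [Fintype S]

theorem sum_pi_succ {n : ℕ} (g : (Fin (n + 1) → S) → ℝ) :
    ∑ z, g z = ∑ s, ∑ y : Fin n → S, g (Fin.cons s y) := by
  rw [← Fintype.sum_prod_type']
  exact (Fintype.sum_equiv (Fin.consEquiv fun _ : Fin (n + 1) => S) _ _ fun _ => rfl).symm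

theorem sum_prod_eq_one {n : ℕ} {w : Fin n → S → ℝ} (hw1 : ∀ i, ∑ s, w i s = 1) :
    ∑ x : Fin n → S, ∏ i, w i (x i) = 1 := by
  rw [← Fintype.piFinset_univ, ← Finset.prod_univ_sum]
  simp [hw1]

theorem sum_prod_mul_exp_pos {n : ℕ} {w : Fin n → S → ℝ} (hw : ∀ i s, 0 ≤ w i s)
    (hw1 : ∀ i, ∑ s, w i s = 1) (h : (Fin n → S) → ℝ) :
    0 < ∑ x : Fin n → S, (∏ i, w i (x i)) * Real.exp (h x) := by
  have hnn : ∀ x : Fin n → S, 0 ≤ ∏ i, w i (x i) := fun x => Finset.prod_nonneg fun i _ => hw i _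
  obtain ⟨x, -, hx⟩ := Finset.exists_lt_of_sum_lt (s := Finset.univ)
    (f := fun _ : Fin n → S => (0 : ℝ)) (g := fun x => ∏ i, w i (x i))
    (by rw [sum_prod_eq_one hw1]; simp)
  exact Finset.sum_pos' (fun x _ => mul_nonneg (hnn x) (Real.exp_pos _).le)
    ⟨x, Finset.mem_univ _, mul_pos hx (Real.exp_pos _)⟩

theorem exists_exp_le_two_sub {r : ℝ} (hr0 : 0 < r) (hr1 : r ≤ 1) :
    ∃ θ : ℝ, 0 ≤ θ ∧ θ ≤ 1 ∧ Real.exp (θ ^ 2 / 8 - (1 - θ) * Real.log r) ≤ 2 - r := by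
  obtain ⟨u, rfl⟩ : ∃ u, r = Real.exp (-u) := ⟨-Real.log r, by simp [Real.exp_log hr0]⟩
  have hu : 0 ≤ u := by
    have := Real.exp_le_one_iff.1 hr1
    linarith
  rw [Real.log_exp]
  have hexp : ∀ v : ℝ, |v| ≤ 1 → Real.exp v ≤ 1 + v + v ^ 2 := fun v hv => by
    have := abs_le.1 (Real.abs_exp_sub_one_sub_id_le hv)
    linarith [this.2]
  by_cases h4 : u ≤ 1 / 4
  · -- The exponent is minimal at `θ = 4 * u`.
    refine ⟨4 * u, by linarith, by linarith, ?_⟩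
    have e1 : (4 * u) ^ 2 / 8 - (1 - 4 * u) * -u = u - 2 * u ^ 2 := by ring
    rw [e1]
    have h1 := hexp (u - 2 * u ^ 2) (abs_le.2 ⟨by nlinarith, by nlinarith⟩)
    have h2 := hexp (-u) (abs_le.2 ⟨by linarith, by linarith⟩)
    have h3 : (u - 2 * u ^ 2) ^ 2 ≤ u ^ 2 := pow_le_pow_left₀ (by nlinarith) (by nlinarith) 2
    nlinarith
  · refine ⟨1, zero_le_one, le_rfl, ?_⟩
    have e1 : (1 : ℝ) ^ 2 / 8 - (1 - 1) * -u = 1 / 8 := by ring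
    rw [e1]
    have h1 := hexp (1 / 8) (abs_le.2 ⟨by norm_num, by norm_num⟩)
    have h2 := hexp (-(1 / 4)) (abs_le.2 ⟨by norm_num, by norm_num⟩)
    have h3 : Real.exp (-u) ≤ Real.exp (-(1 / 4)) := Real.exp_le_exp.2 (by linarith)
    linarith

/-- Hölder's inequality for the exponents `1 / (1 - θ)` and `1 / θ`, in exponential form. -/
theorem sum_exp_convex_comb_le {ι : Type*} [Fintype ι] {w p q : ι → ℝ} (hw : ∀ i, 0 ≤ w i)
    {α β θ : ℝ} (h0 : 0 ≤ θ) (h1 : θ ≤ 1) (hp : ∑ i, w i * Real.exp (p i) ≤ Real.exp α)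
    (hq : ∑ i, w i * Real.exp (q i) ≤ Real.exp β) :
    ∑ i, w i * Real.exp ((1 - θ) * p i + θ * q i) ≤ Real.exp ((1 - θ) * α + θ * β) := by
  have h1' : 0 ≤ 1 - θ := by linarith
  have hp' : ∑ i, w i * Real.exp (p i - α) ≤ 1 := by
    simp only [Real.exp_sub, ← mul_div_assoc, ← Finset.sum_div]
    exact (div_le_one (Real.exp_pos _)).2 hp
  have hq' : ∑ i, w i * Real.exp (q i - β) ≤ 1 := by
    simp only [Real.exp_sub, ← mul_div_assoc, ← Finset.sum_div]
    exact (div_le_one (Real.exp_pos _)).2 hq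
  rw [← div_le_one (Real.exp_pos _), Finset.sum_div]
  calc ∑ i, w i * Real.exp ((1 - θ) * p i + θ * q i) / Real.exp ((1 - θ) * α + θ * β)
      ≤ ∑ i, ((1 - θ) * (w i * Real.exp (p i - α)) + θ * (w i * Real.exp (q i - β))) := by
        refine Finset.sum_le_sum fun i _ => ?_
        rw [mul_div_assoc, ← Real.exp_sub]
        have := convexOn_exp.2 (Set.mem_univ (p i - α)) (Set.mem_univ (q i - β)) h1' h0 (by ring)
        simp only [smul_eq_mul] at this
        have e : (1 - θ) * p i + θ * q i - ((1 - θ) * α + θ * β) =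
          (1 - θ) * (p i - α) + θ * (q i - β) := by ring
        rw [e]
        linarith [mul_le_mul_of_nonneg_left this (hw i)]
    _ ≤ 1 := by
        rw [Finset.sum_add_distrib, ← Finset.mul_sum, ← Finset.mul_sum]
        nlinarith

variable [DecidableEq S]

/-- The cost of moving the point `x` to a random point with law `ν` in the weak transport problem
with potential `h`: the mean of `h`, plus a penalty quadratic in the probabilities that the
single coordinates change. -/
noncomputable def moveCost {n : ℕ} (h : (Fin n → S) → ℝ) (x : Fin n → S)
    (ν : (Fin n → S) → ℝ) : ℝ :=
  ∑ y, ν y * h y + 1 / 8 * ∑ i, (∑ y, ν y * if y i ≠ x i then 1 else 0) ^ 2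

/-- The infimum convolution of `h` with the quadratic penalty of `moveCost`, over all laws on the
finite product `Fin n → S`. -/
noncomputable def talagrandConv {n : ℕ} (h : (Fin n → S) → ℝ) (x : Fin n → S) : ℝ :=
  ⨅ ν : stdSimplex ℝ (Fin n → S), moveCost h x ν

theorem bddBelow_moveCost {n : ℕ} (h : (Fin n → S) → ℝ) (x : Fin n → S) :
    BddBelow (Set.range fun ν : stdSimplex ℝ (Fin n → S) => moveCost h x ν) := by
  refine ⟨-∑ y, |h y|, ?_⟩
  rintro _ ⟨ν, rfl⟩
  have h1 : -∑ y, |h y| ≤ ∑ y, ν y * h y := by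
    rw [← Finset.sum_neg_distrib]
    refine Finset.sum_le_sum fun y _ => ?_
    have h0 := ν.2.1 y
    have h2 : ν y ≤ 1 := stdSimplex.le_one ν y
    have h3 : ν y * |h y| ≤ |h y| := mul_le_of_le_one_left (abs_nonneg _) h2
    have h4 : ν y * -|h y| ≤ ν y * h y := mul_le_mul_of_nonneg_left (neg_abs_le _) h0
    linarith
  have h2 : 0 ≤ 1 / 8 * ∑ i, (∑ y, ν y * if y i ≠ x i then (1 : ℝ) else 0) ^ 2 :=
    mul_nonneg (by norm_num) (Finset.sum_nonneg fun i _ => sq_nonneg _)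
  show _ ≤ moveCost h x ν
  unfold moveCost
  linarith

theorem talagrandConv_le {n : ℕ} (h : (Fin n → S) → ℝ) (x : Fin n → S) {ν : (Fin n → S) → ℝ}
    (hν : ν ∈ stdSimplex ℝ (Fin n → S)) : talagrandConv h x ≤ moveCost h x ν :=
  ciInf_le (bddBelow_moveCost h x) ⟨ν, hν⟩

theorem nonempty_stdSimplex_pi {n : ℕ} (x : Fin n → S) :
    Nonempty (stdSimplex ℝ (Fin n → S)) :=
  ⟨Pi.single x 1, single_mem_stdSimplex ℝ x⟩

theorem exists_moveCost_lt {n : ℕ} (h : (Fin n → S) → ℝ) (x : Fin n → S) {c : ℝ}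
    (hc : talagrandConv h x < c) : ∃ ν ∈ stdSimplex ℝ (Fin n → S), moveCost h x ν < c := by
  have := nonempty_stdSimplex_pi x
  obtain ⟨ν, hν⟩ := exists_lt_of_ciInf_lt hc
  exact ⟨ν, ν.2, hν⟩

/-- The law of `Fin.cons (e Y) Y`, where `Y` has law `ν`. -/
def consLaw {n : ℕ} (e : (Fin n → S) → S) (ν : (Fin n → S) → ℝ) (z : Fin (n + 1) → S) : ℝ :=
  if z 0 = e (Fin.tail z) then ν (Fin.tail z) else 0

theorem sum_consLaw_mul {n : ℕ} (e : (Fin n → S) → S) (ν : (Fin n → S) → ℝ)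
    (g : (Fin (n + 1) → S) → ℝ) :
    ∑ z, consLaw e ν z * g z = ∑ y, ν y * g (Fin.cons (e y) y) := by
  rw [sum_pi_succ, Finset.sum_comm]
  refine Finset.sum_congr rfl fun y _ => ?_
  simp [consLaw, ite_mul]

theorem consLaw_mem_stdSimplex {n : ℕ} (e : (Fin n → S) → S) {ν : (Fin n → S) → ℝ}
    (hν : ν ∈ stdSimplex ℝ (Fin n → S)) : consLaw e ν ∈ stdSimplex ℝ (Fin (n + 1) → S) := by
  refine ⟨fun z => ?_, ?_⟩
  · unfold consLaw
    split_ifs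
    exacts [hν.1 _, le_rfl]
  · have := sum_consLaw_mul e ν fun _ => 1
    simpa [hν.2] using this

/-- The basic recursion: with probability `1 - θ` keep the first coordinate, and with probability
`θ` replace it by the best one. -/
theorem talagrandConv_cons_le {n : ℕ} (h : (Fin (n + 1) → S) → ℝ) (e : (Fin n → S) → S)
    (s : S) (x : Fin n → S) {θ : ℝ} (h0 : 0 ≤ θ) (h1 : θ ≤ 1) :
    talagrandConv h (Fin.cons s x : Fin (n + 1) → S) ≤
      (1 - θ) * talagrandConv (fun y => h (Fin.cons s y)) x +
        θ * talagrandConv (fun y => h (Fin.cons (e y) y)) x + θ ^ 2 / 8 := by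
  refine le_of_forall_pos_le_add fun ε hε => ?_
  obtain ⟨ν, hν, hνc⟩ := exists_moveCost_lt (fun y => h (Fin.cons s y)) x
    (lt_add_of_pos_right _ hε)
  obtain ⟨μ, hμ, hμc⟩ := exists_moveCost_lt (fun y => h (Fin.cons (e y) y)) x
    (lt_add_of_pos_right _ hε)
  have h1' : 0 ≤ 1 - θ := by linarith
  have hmem := convex_stdSimplex ℝ (Fin (n + 1) → S) (consLaw_mem_stdSimplex (fun _ => s) hν)
    (consLaw_mem_stdSimplex e hμ) h1' h0 (by ring)
  refine (talagrandConv_le h _ hmem).trans ?_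
  have hsum : ∀ g : (Fin (n + 1) → S) → ℝ,
      ∑ z, ((1 - θ) • consLaw (fun _ => s) ν + θ • consLaw e μ) z * g z =
        (1 - θ) * ∑ y, ν y * g (Fin.cons s y) + θ * ∑ y, μ y * g (Fin.cons (e y) y) := by
    intro g
    rw [← sum_consLaw_mul (fun _ => s), ← sum_consLaw_mul e, Finset.mul_sum, Finset.mul_sum,
      ← Finset.sum_add_distrib]
    refine Finset.sum_congr rfl fun z _ => ?_
    simp only [Pi.add_apply, Pi.smul_apply, smul_eq_mul]
    ring
  have hfirst : (∑ y, μ y * if e y ≠ s then (1 : ℝ) else 0) ^ 2 ≤ 1 := by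
    have hnn : 0 ≤ ∑ y, μ y * if e y ≠ s then (1 : ℝ) else 0 :=
      Finset.sum_nonneg fun y _ => mul_nonneg (hμ.1 y) (by split_ifs <;> norm_num)
    refine pow_le_one₀ hnn ?_
    refine (Finset.sum_le_sum fun y _ => mul_le_of_le_one_right (hμ.1 y) ?_).trans hμ.2.le
    split_ifs <;> norm_num
  have hrest : ∑ i : Fin n, ((1 - θ) * ∑ y, ν y * (if y i ≠ x i then (1 : ℝ) else 0) +
        θ * ∑ y, μ y * (if y i ≠ x i then (1 : ℝ) else 0)) ^ 2 ≤
      (1 - θ) * ∑ i, (∑ y, ν y * (if y i ≠ x i then (1 : ℝ) else 0)) ^ 2 +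
        θ * ∑ i, (∑ y, μ y * (if y i ≠ x i then (1 : ℝ) else 0)) ^ 2 := by
    rw [Finset.mul_sum, Finset.mul_sum, ← Finset.sum_add_distrib]
    refine Finset.sum_le_sum fun i _ => ?_
    -- Convexity of the square.
    nlinarith [mul_nonneg (mul_nonneg h1' h0)
      (sq_nonneg (∑ y, ν y * (if y i ≠ x i then (1 : ℝ) else 0) -
        ∑ y, μ y * (if y i ≠ x i then (1 : ℝ) else 0)))]
  unfold moveCost at hνc hμc ⊢
  simp only [hsum, Fin.sum_univ_succ, Fin.cons_zero, Fin.cons_succ, ne_eq, not_true_eq_false,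
    if_false, mul_zero, Finset.sum_const_zero, zero_add] at hνc hμc hrest hfirst ⊢
  have hA := mul_le_mul_of_nonneg_left hνc.le h1'
  have hB := mul_le_mul_of_nonneg_left hμc.le h0
  have hC := mul_le_mul_of_nonneg_left hfirst (sq_nonneg θ)
  rw [mul_pow]
  linarith

/-- Talagrand's convex distance inequality in functional form, for a product of probability
measures on a finite set. The induction is on the number of factors. -/
theorem talagrand_functional {n : ℕ} {w : Fin n → S → ℝ} (hw : ∀ i s, 0 ≤ w i s)
    (hw1 : ∀ i, ∑ s, w i s = 1) (h : (Fin n → S) → ℝ) :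
    (∑ x : Fin n → S, (∏ i, w i (x i)) * Real.exp (talagrandConv h x)) *
      (∑ x : Fin n → S, (∏ i, w i (x i)) * Real.exp (-h x)) ≤ 1 := by
  induction n with
  | zero =>
    have hq : talagrandConv h default ≤ h default := by
      refine (talagrandConv_le h default (single_mem_stdSimplex ℝ default)).trans ?_
      simp [moveCost]
    simp only [Finset.univ_unique, Finset.sum_singleton, Finset.univ_eq_empty,
      Finset.prod_empty, one_mul, ← Real.exp_add]
    exact Real.exp_le_one_iff.2 (by linarith)
  | succ n ih =>
    have hne : Nonempty S := by
      by_contra hcon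
      rw [not_nonempty_iff] at hcon
      simpa using hw1 0
    -- The best first coordinate for each choice of the others.
    have hmin : ∀ y : Fin n → S, ∃ s, ∀ t, h (Fin.cons s y) ≤ h (Fin.cons t y) := fun y =>
      Finite.exists_min fun s => h (Fin.cons s y)
    choose e he using hmin
    let v : (Fin n → S) → ℝ := fun y => ∏ i, w i.succ (y i)
    have hv : ∀ y, 0 ≤ v y := fun y => Finset.prod_nonneg fun i _ => hw _ _
    let I : S → ℝ := fun s => ∑ y, v y * Real.exp (-h (Fin.cons s y))
    let J : ℝ := ∑ y, v y * Real.exp (-h (Fin.cons (e y) y))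
    have hI : ∀ s, 0 < I s := fun s => sum_prod_mul_exp_pos (fun i => hw i.succ)
      (fun i => hw1 i.succ) _
    have hJ : 0 < J := sum_prod_mul_exp_pos (fun i => hw i.succ) (fun i => hw1 i.succ) _
    have hIJ : ∀ s, I s ≤ J := fun s => Finset.sum_le_sum fun y _ =>
      mul_le_mul_of_nonneg_left (Real.exp_le_exp.2 (neg_le_neg (he y s))) (hv y)
    have hsplit : ∀ g : (Fin (n + 1) → S) → ℝ,
        ∑ x : Fin (n + 1) → S, (∏ i, w i (x i)) * g x =
          ∑ s, w 0 s * ∑ y, v y * g (Fin.cons s y) := by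
      intro g
      rw [sum_pi_succ]
      refine Finset.sum_congr rfl fun s _ => ?_
      rw [Finset.mul_sum]
      refine Finset.sum_congr rfl fun y _ => ?_
      rw [Fin.prod_univ_succ]
      simp only [Fin.cons_zero, Fin.cons_succ, v]
      ring
    have hinner : ∀ s, ∑ y, v y * Real.exp (talagrandConv h (Fin.cons s y : Fin (n + 1) → S)) ≤
        (2 - I s / J) / J := by
      intro s
      obtain ⟨θ, h0, h1, hθ⟩ := exists_exp_le_two_sub (div_pos (hI s) hJ)
        ((div_le_one hJ).2 (hIJ s))
      have hp := ih (fun i => hw i.succ) (fun i => hw1 i.succ) fun y => h (Fin.cons s y)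
      have hq := ih (fun i => hw i.succ) (fun i => hw1 i.succ) fun y => h (Fin.cons (e y) y)
      have hp' := (le_div_iff₀ (hI s)).2 hp
      have hq' := (le_div_iff₀ hJ).2 hq
      rw [one_div, ← Real.exp_log (hI s), ← Real.exp_neg] at hp'
      rw [one_div, ← Real.exp_log hJ, ← Real.exp_neg] at hq'
      have hH := sum_exp_convex_comb_le hv h0 h1 hp' hq'
      calc ∑ y, v y * Real.exp (talagrandConv h (Fin.cons s y : Fin (n + 1) → S))
          ≤ ∑ y, v y * Real.exp ((1 - θ) * talagrandConv (fun y => h (Fin.cons s y)) y +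
              θ * talagrandConv (fun y => h (Fin.cons (e y) y)) y + θ ^ 2 / 8) :=
            Finset.sum_le_sum fun y _ => mul_le_mul_of_nonneg_left
              (Real.exp_le_exp.2 (talagrandConv_cons_le h e s y h0 h1)) (hv y)
        _ = Real.exp (θ ^ 2 / 8) * ∑ y, v y * Real.exp
              ((1 - θ) * talagrandConv (fun y => h (Fin.cons s y)) y +
              θ * talagrandConv (fun y => h (Fin.cons (e y) y)) y) := by
            rw [Finset.mul_sum]
            refine Finset.sum_congr rfl fun y _ => ?_
            rw [Real.exp_add _ (θ ^ 2 / 8)]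
            ring
        _ ≤ Real.exp (θ ^ 2 / 8) *
              Real.exp ((1 - θ) * -Real.log (I s) + θ * -Real.log J) :=
            mul_le_mul_of_nonneg_left hH (Real.exp_pos _).le
        _ = Real.exp (θ ^ 2 / 8 - (1 - θ) * Real.log (I s / J)) / J := by
            rw [Real.log_div (hI s).ne' hJ.ne', ← Real.exp_add,
              eq_div_iff hJ.ne']
            nth_rw 2 [← Real.exp_log hJ]
            rw [← Real.exp_add]
            congr 1
            ring
        _ ≤ (2 - I s / J) / J := by gcongr
    rw [hsplit fun x => Real.exp (talagrandConv h x), hsplit fun x => Real.exp (-h x)]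
    have hsum : ∑ s, w 0 s * ∑ y, v y *
        Real.exp (talagrandConv h (Fin.cons s y : Fin (n + 1) → S)) ≤
          (2 - (∑ s, w 0 s * I s) / J) / J := by
      calc _ ≤ ∑ s, w 0 s * ((2 - I s / J) / J) :=
            Finset.sum_le_sum fun s _ => mul_le_mul_of_nonneg_left (hinner s) (hw 0 s)
        _ = ∑ s, (2 / J * w 0 s - 1 / J ^ 2 * (w 0 s * I s)) := by
            refine Finset.sum_congr rfl fun s _ => ?_
            field_simp
        _ = _ := by
            rw [Finset.sum_sub_distrib, ← Finset.mul_sum, ← Finset.mul_sum, hw1 0]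
            field_simp
    have hInn : 0 ≤ ∑ s, w 0 s * I s :=
      Finset.sum_nonneg fun s _ => mul_nonneg (hw 0 s) (hI s).le
    refine (mul_le_mul_of_nonneg_right hsum hInn).trans ?_
    change (2 - (∑ s, w 0 s * I s) / J) / J * (∑ s, w 0 s * I s) ≤ 1
    have e1 : (2 - (∑ s, w 0 s * I s) / J) / J * (∑ s, w 0 s * I s) =
        1 - (1 - (∑ s, w 0 s * I s) / J) ^ 2 := by
      field_simp
      ring
    rw [e1]
    linarith [sq_nonneg (1 - (∑ s, w 0 s * I s) / J)]

/-- Talagrand's inequality on a finite product space, for a function whose variation is bounded by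
weights `a` that may depend on `x` (but not on `y`) and whose squares add up to at most `c`. -/
theorem sum_exp_mul_sum_exp_neg_le {n : ℕ} {w : Fin n → S → ℝ} (hw : ∀ i s, 0 ≤ w i s)
    (hw1 : ∀ i, ∑ s, w i s = 1) {f : (Fin n → S) → ℝ} {c : ℝ}
    (hf : ∀ x, ∃ a : Fin n → ℝ, ∑ i, a i ^ 2 ≤ c ∧
      ∀ y, f x ≤ f y + ∑ i, if y i ≠ x i then a i else 0) {l : ℝ} (hl : 0 ≤ l) :
    (∑ x : Fin n → S, (∏ i, w i (x i)) * Real.exp (l * f x)) *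
      (∑ x : Fin n → S, (∏ i, w i (x i)) * Real.exp (-l * f x)) ≤ Real.exp (2 * l ^ 2 * c) := by
  have hnn : ∀ x : Fin n → S, 0 ≤ ∏ i, w i (x i) := fun x => Finset.prod_nonneg fun i _ => hw i _
  have hconv : ∀ x, l * f x ≤ talagrandConv (fun y => l * f y) x + 2 * l ^ 2 * c := by
    intro x
    have := nonempty_stdSimplex_pi x
    obtain ⟨a, ha, hfa⟩ := hf x
    rw [← sub_le_iff_le_add]
    refine le_ciInf fun ⟨ν, hν⟩ => ?_
    have h1 : l * f x - l * ∑ i, a i * ∑ y, ν y * (if y i ≠ x i then 1 else 0) ≤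
        ∑ y, ν y * (l * f y) := by
      have e1 : ∑ y, ν y * (l * (f x - ∑ i, a i * if y i ≠ x i then 1 else 0)) =
          l * f x - l * ∑ i, a i * ∑ y, ν y * (if y i ≠ x i then 1 else 0) := by
        have e2 : ∀ y, ν y * (l * (f x - ∑ i, a i * if y i ≠ x i then 1 else 0)) =
            ν y * (l * f x) - l * ∑ i, a i * (ν y * if y i ≠ x i then 1 else 0) := by
          intro y
          have : ∑ i, a i * (ν y * if y i ≠ x i then (1 : ℝ) else 0) =
              ν y * ∑ i, a i * if y i ≠ x i then 1 else 0 := by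
            rw [Finset.mul_sum]
            exact Finset.sum_congr rfl fun i _ => by ring
          rw [this]
          ring
        simp_rw [e2]
        rw [Finset.sum_sub_distrib, ← Finset.sum_mul, hν.2, one_mul, ← Finset.mul_sum,
          Finset.sum_comm]
        simp_rw [Finset.mul_sum]
      rw [← e1]
      refine Finset.sum_le_sum fun y _ => mul_le_mul_of_nonneg_left
        (mul_le_mul_of_nonneg_left ?_ hl) (hν.1 y)
      have := hfa y
      simp only [mul_ite, mul_one, mul_zero]
      linarith
    have h2 : l * ∑ i, a i * ∑ y, ν y * (if y i ≠ x i then 1 else 0) ≤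
        2 * l ^ 2 * ∑ i, a i ^ 2 +
          1 / 8 * ∑ i, (∑ y, ν y * (if y i ≠ x i then (1 : ℝ) else 0)) ^ 2 := by
      rw [Finset.mul_sum, Finset.mul_sum, Finset.mul_sum, ← Finset.sum_add_distrib]
      refine Finset.sum_le_sum fun i _ => ?_
      nlinarith [sq_nonneg (4 * l * a i - ∑ y, ν y * (if y i ≠ x i then (1 : ℝ) else 0))]
    have h3 : 2 * l ^ 2 * ∑ i, a i ^ 2 ≤ 2 * l ^ 2 * c :=
      mul_le_mul_of_nonneg_left ha (by positivity)
    show _ ≤ moveCost _ x ν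
    unfold moveCost
    linarith
  have hmain := talagrand_functional hw hw1 fun y => l * f y
  have hpos := sum_prod_mul_exp_pos hw hw1 fun y => -l * f y
  calc _ ≤ (Real.exp (2 * l ^ 2 * c) * ∑ x : Fin n → S, (∏ i, w i (x i)) *
          Real.exp (talagrandConv (fun y => l * f y) x)) *
        (∑ x : Fin n → S, (∏ i, w i (x i)) * Real.exp (-l * f x)) := by
        refine mul_le_mul_of_nonneg_right ?_ hpos.le
        rw [Finset.mul_sum]
        refine Finset.sum_le_sum fun x _ => ?_
        have := mul_le_mul_of_nonneg_left (Real.exp_le_exp.2 (hconv x)) (hnn x)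
        rw [Real.exp_add] at this
        linarith
    _ ≤ Real.exp (2 * l ^ 2 * c) * 1 := by
        rw [mul_assoc]
        refine mul_le_mul_of_nonneg_left ?_ (Real.exp_pos _).le
        simpa only [neg_mul] using hmain
    _ = _ := mul_one _

end Talagrand

/-! ### Talagrand's inequality for independent random points -/

theorem integral_comp_eq_sum_prod {Ω S : Type*} [MeasurableSpace Ω] {P : Measure Ω}
    [IsProbabilityMeasure P] [Fintype S] [MeasurableSpace S] [MeasurableSingletonClass S] {n : ℕ}
    {Y : Fin n → Ω → S} (hY : ∀ i, Measurable (Y i)) (hind : iIndepFun Y P)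
    (g : (Fin n → S) → ℝ) :
    ∫ ω, g (fun i => Y i ω) ∂P = ∑ x : Fin n → S, (∏ i, (P.map (Y i)).real {x i}) * g x := by
  have hpr : ∀ i, IsProbabilityMeasure (P.map (Y i)) := fun i =>
    Measure.isProbabilityMeasure_map (hY i).aemeasurable
  rw [← integral_map (φ := fun ω i => Y i ω) (f := g) (measurable_pi_lambda _ hY).aemeasurable
    (measurable_of_finite g).aestronglyMeasurable,
    hind.map_fun_eq_pi_map fun i => (hY i).aemeasurable, integral_fintype .of_finite]
  refine Finset.sum_congr rfl fun x _ => ?_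
  rw [smul_eq_mul, Measure.real, Measure.pi_singleton, ENNReal.toReal_prod]
  rfl

/-- Talagrand's inequality for a function of independent random variables with values in a finite
set: `sum_exp_mul_sum_exp_neg_le` in terms of moment generating functions. -/
theorem mgf_mul_mgf_neg_le_of_fintype {Ω S : Type*} [MeasurableSpace Ω] {P : Measure Ω}
    [IsProbabilityMeasure P] [Fintype S] [MeasurableSpace S] [MeasurableSingletonClass S] {n : ℕ}
    {Y : Fin n → Ω → S} (hY : ∀ i, Measurable (Y i)) (hind : iIndepFun Y P)
    {f : (Fin n → S) → ℝ} {c : ℝ}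
    (hf : ∀ x, ∃ a : Fin n → ℝ, ∑ i, a i ^ 2 ≤ c ∧
      ∀ y, f x ≤ f y + ∑ i, open Classical in if y i ≠ x i then a i else 0)
    {l : ℝ} (hl : 0 ≤ l) :
    mgf (fun ω => f fun i => Y i ω) P l * mgf (fun ω => f fun i => Y i ω) P (-l) ≤
      Real.exp (2 * l ^ 2 * c) := by
  classical
  unfold mgf
  rw [integral_comp_eq_sum_prod hY hind fun x => Real.exp (l * f x),
    integral_comp_eq_sum_prod hY hind fun x => Real.exp (-l * f x)]
  refine sum_exp_mul_sum_exp_neg_le (fun i s => measureReal_nonneg) (fun i => ?_) hf hl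
  have : IsProbabilityMeasure (P.map (Y i)) :=
    Measure.isProbabilityMeasure_map (hY i).aemeasurable
  rw [sum_measureReal_singleton, Finset.coe_univ, probReal_univ]

theorem integrable_exp_mul_of_abs_le {Ω : Type*} [MeasurableSpace Ω] {P : Measure Ω}
    [IsProbabilityMeasure P] {Z : Ω → ℝ} (hZ : AEMeasurable Z P) {R : ℝ}
    (hR : ∀ᵐ ω ∂P, |Z ω| ≤ R) (l : ℝ) : Integrable (fun ω => Real.exp (l * Z ω)) P := by
  refine Integrable.of_bound (C := Real.exp (|l| * R)) (by fun_prop) ?_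
  filter_upwards [hR] with ω hω
  rw [Real.norm_eq_abs, Real.abs_exp, Real.exp_le_exp]
  calc l * Z ω ≤ |l * Z ω| := le_abs_self _
    _ = |l| * |Z ω| := abs_mul _ _
    _ ≤ |l| * R := by gcongr

/-- The extension of `mgf_mul_mgf_neg_le_of_fintype` to continuous bounded functions on a set `s`
and arbitrary laws on `s`, by approximation of the laws with finitely supported ones. -/
theorem mgf_mul_mgf_neg_le {Ω E : Type*} [MeasurableSpace Ω] {P : Measure Ω}
    [IsProbabilityMeasure P] [PseudoMetricSpace E] [SecondCountableTopology E] [MeasurableSpace E]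
    [OpensMeasurableSpace E] [MeasurableSingletonClass E] {s : Set E} {e₀ : E} (he₀ : e₀ ∈ s)
    {n : ℕ} {X : Fin n → Ω → E} (hX : ∀ i, Measurable (X i)) (hXs : ∀ i, ∀ᵐ ω ∂P, X i ω ∈ s)
    (hind : iIndepFun X P) {f : (Fin n → E) → ℝ} (hfc : Continuous f) {R : ℝ}
    (hR : ∀ x, (∀ i, x i ∈ s) → |f x| ≤ R) {c : ℝ}
    (hf : ∀ x, (∀ i, x i ∈ s) → ∃ a : Fin n → ℝ, ∑ i, a i ^ 2 ≤ c ∧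
      ∀ y, f x ≤ f y + ∑ i, open Classical in if y i ≠ x i then a i else 0)
    {l : ℝ} (hl : 0 ≤ l) :
    mgf (fun ω => f fun i => X i ω) P l * mgf (fun ω => f fun i => X i ω) P (-l) ≤
      Real.exp (2 * l ^ 2 * c) := by
  let φ : ℕ → SimpleFunc E E := fun k => SimpleFunc.approxOn id measurable_id s e₀ he₀ k
  have hφs : ∀ k p, φ k p ∈ s := fun k p => SimpleFunc.approxOn_mem measurable_id he₀ k p
  have hlim : ∀ t : ℝ, Filter.Tendsto (fun k => mgf (fun ω => f fun i => φ k (X i ω)) P t)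
      Filter.atTop (nhds (mgf (fun ω => f fun i => X i ω) P t)) := by
    intro t
    refine tendsto_integral_of_dominated_convergence (fun _ => Real.exp (|t| * R)) (fun k => ?_)
      (integrable_const _) (fun k => ?_) ?_
    · have h1 : Measurable fun ω => (fun i => φ k (X i ω) : Fin n → E) :=
        measurable_pi_lambda _ fun i => (φ k).measurable.comp (hX i)
      exact (Real.measurable_exp.comp ((hfc.measurable.comp h1).const_mul t)).aestronglyMeasurable
    · refine Filter.Eventually.of_forall fun ω => ?_
      rw [Real.norm_eq_abs, Real.abs_exp, Real.exp_le_exp]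
      calc t * f (fun i => φ k (X i ω)) ≤ |t * f (fun i => φ k (X i ω))| := le_abs_self _
        _ = |t| * |f (fun i => φ k (X i ω))| := abs_mul _ _
        _ ≤ |t| * R := by gcongr; exact hR _ fun i => hφs k _
    · filter_upwards [ae_all_iff.2 hXs] with ω hω
      have h1 : Filter.Tendsto (fun k => (fun i => φ k (X i ω) : Fin n → E)) Filter.atTop
          (nhds fun i => X i ω) := tendsto_pi_nhds.2 fun i =>
        SimpleFunc.tendsto_approxOn measurable_id he₀ (subset_closure (hω i))
      exact (Real.continuous_exp.tendsto _).comp (((hfc.tendsto _).comp h1).const_mul t)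
  refine le_of_tendsto ((hlim l).mul (hlim (-l))) (Filter.Eventually.of_forall fun k => ?_)
  let ψ : E → (φ k).range := fun p => ⟨φ k p, (φ k).mem_range_self p⟩
  have hψ : Measurable ψ := (φ k).measurable.subtype_mk
  have hs : ∀ p : (φ k).range, (p : E) ∈ s := by
    rintro ⟨p, hp⟩
    obtain ⟨q, rfl⟩ := SimpleFunc.mem_range.1 hp
    exact hφs k q
  refine mgf_mul_mgf_neg_le_of_fintype (Y := fun i ω => ψ (X i ω))
    (f := fun x => f fun i => (x i : E)) (fun i => hψ.comp (hX i))
    (hind.comp (fun _ => ψ) fun _ => hψ) (fun x => ?_) hl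
  obtain ⟨a, ha, hfa⟩ := hf (fun i => x i) fun i => hs _
  refine ⟨a, ha, fun y => ?_⟩
  refine (hfa fun i => y i).trans_eq (congrArg _ ?_)
  exact Finset.sum_congr rfl fun i _ => by
    by_cases h : y i = x i
    · simp [h]
    · simp [h, Subtype.ext_iff.not.1 h]

/-- Concentration around a median by Chernoff's bound. The bound on the product of the two moment
generating functions controls `P (a + t ≤ Z) * P (Z ≤ a)` for every `a`. For `a = M` the second
factor is at least `1 / 2`, which gives the upper tail; for `a = M - t` the first one is, which
gives the lower tail. -/
theorem measureReal_le_abs_sub_median {Ω : Type u} [MeasurableSpace Ω] {P : Measure Ω}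
    [IsProbabilityMeasure P] {Z : Ω → ℝ} {c : ℝ} (hc : 0 < c)
    (hint : ∀ l : ℝ, Integrable (fun ω => Real.exp (l * Z ω)) P)
    (hmgf : ∀ l : ℝ, 0 ≤ l → mgf Z P l * mgf Z P (-l) ≤ Real.exp (2 * l ^ 2 * c))
    {M : ℝ} (hM : IsMedian P Z M) {t : ℝ} (ht : 0 ≤ t) :
    P.real {ω | t ≤ |Z ω - M|} ≤ 4 * Real.exp (-(t ^ 2) / (8 * c)) := by
  have key : ∀ a : ℝ, P.real {ω | a + t ≤ Z ω} * P.real {ω | Z ω ≤ a} ≤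
      Real.exp (-(t ^ 2) / (8 * c)) := by
    intro a
    -- The optimal exponent in `exp (2 * l ^ 2 * c - l * t)`.
    have hl : 0 ≤ t / (4 * c) := by positivity
    have h1 := measure_ge_le_exp_mul_mgf (μ := P) (X := Z) (a + t) hl (hint _)
    have h2 := measure_le_le_exp_mul_mgf (μ := P) (X := Z) a (neg_nonpos.2 hl) (hint _)
    calc _ ≤ (Real.exp (-(t / (4 * c)) * (a + t)) * mgf Z P (t / (4 * c))) *
          (Real.exp (-(-(t / (4 * c))) * a) * mgf Z P (-(t / (4 * c)))) :=
          mul_le_mul h1 h2 measureReal_nonneg (mul_nonneg (Real.exp_pos _).le mgf_nonneg)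
      _ = Real.exp (-(t / (4 * c)) * (a + t)) * Real.exp (-(-(t / (4 * c))) * a) *
          (mgf Z P (t / (4 * c)) * mgf Z P (-(t / (4 * c)))) := by ring
      _ ≤ Real.exp (-(t / (4 * c)) * (a + t)) * Real.exp (-(-(t / (4 * c))) * a) *
          Real.exp (2 * (t / (4 * c)) ^ 2 * c) :=
          mul_le_mul_of_nonneg_left (hmgf _ hl) (by positivity)
      _ = _ := by
          rw [← Real.exp_add, ← Real.exp_add]
          congr 1
          field_simp
          ring
  have hup := key M
  have hlow := key (M - t)
  rw [sub_add_cancel] at hlow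
  have hup' := mul_le_mul_of_nonneg_left hM.1
    (measureReal_nonneg (μ := P) (s := {ω | M + t ≤ Z ω}))
  have hlow' := mul_le_mul_of_nonneg_right hM.2
    (measureReal_nonneg (μ := P) (s := {ω | Z ω ≤ M - t}))
  have hsub : {ω | t ≤ |Z ω - M|} ⊆ {ω | M + t ≤ Z ω} ∪ {ω | Z ω ≤ M - t} := by
    intro ω hω
    rcases le_abs.1 (show t ≤ |Z ω - M| from hω) with h | h
    · exact Or.inl (show M + t ≤ Z ω by linarith)
    · exact Or.inr (show Z ω ≤ M - t by linarith)
  have h1 := (measureReal_mono hsub (measure_ne_top P _)).trans (measureReal_union_le _ _)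
  linarith

/-! ### Concentration of the facility location cost -/

theorem measureReal_le_abs_facilityCost_sub {n : ℕ} (hn : 1 ≤ n) {Ω : Type u}
    [MeasurableSpace Ω] {P : Measure Ω} [IsProbabilityMeasure P] {X : Fin n → Ω → Plane}
    (hX : ∀ i, Measurable (X i)) (hXs : ∀ i, ∀ᵐ ω ∂P, X i ω ∈ unitSquare)
    (hind : iIndepFun X P) {M : ℝ} (hM : IsMedian P (fun ω => facilityCost (fun i => X i ω)) M)
    {t : ℝ} (ht : 0 ≤ t) :
    P.real {ω | t ≤ |facilityCost (fun i => X i ω) - M|} ≤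
      4 * Real.exp (-(t ^ 2) / (2560 * (n : ℝ) ^ (2 / 3 : ℝ))) := by
  have hn' : (0 : ℝ) < n := by exact_mod_cast hn
  have hbound : ∀ x : Fin n → Plane, (∀ i, x i ∈ unitSquare) → |facilityCost x| ≤ 1 + 2 * n :=
    fun x hx => by
      rw [abs_of_nonneg (facilityCost_nonneg x)]
      exact facilityCost_le_of_mem hx
  have hmeas : Measurable fun ω => facilityCost fun i => X i ω :=
    continuous_facilityCost.measurable.comp (measurable_pi_lambda _ hX)
  have h := measureReal_le_abs_sub_median (c := 320 * (n : ℝ) ^ (2 / 3 : ℝ)) (by positivity)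
    (integrable_exp_mul_of_abs_le hmeas.aemeasurable (R := 1 + 2 * n) (by
      filter_upwards [ae_all_iff.2 hXs] with ω hω using hbound _ hω))
    (fun l hl => mgf_mul_mgf_neg_le zero_mem_unitSquare hX hXs hind continuous_facilityCost hbound
      (fun x hx => by
        obtain ⟨a, ha, hfa⟩ := exists_facilityCost_weights hn hx
        refine ⟨a, ha, fun y => ?_⟩
        convert hfa y) hl) hM ht
  rwa [← mul_assoc, show (8 : ℝ) * 320 = 2560 by norm_num] at h

theorem theorem3p2 :
    ∃ K : ℝ, 0 < K ∧ ∃ A : ℝ, 0 < A ∧ ∃ L : ℝ → ℝ,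
      ∀ (n : ℕ), 1 ≤ n →
      ∀ (Ω : Type u) [MeasurableSpace Ω] (P : Measure Ω) [IsProbabilityMeasure P]
        (X : Fin n → Ω → Plane),
        (∀ i, Measurable (X i)) →
        (∀ i, ∀ᵐ ω ∂P, X i ω ∈ unitSquare) →
        iIndepFun X P →
        ∀ M : ℝ, IsMedian P (fun ω => facilityCost (fun i => X i ω)) M →
          (∀ t : ℝ, 0 ≤ t →
            P.real {ω | t ≤ |facilityCost (fun i => X i ω) - M|} ≤
              2 * Real.exp (-(t ^ 2) / (K * (n : ℝ) ^ (2 / 3 : ℝ)))) ∧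
          (∀ t : ℝ, A * (n : ℝ) ^ (1 / 3 : ℝ) ≤ t →
            P.real {ω | t ≤ |facilityCost (fun i => X i ω) - M|} ≤
              Real.exp (-(t ^ 2) / (K * (n : ℝ) ^ (2 / 3 : ℝ)))) ∧
          (∀ ε : ℝ, 0 < ε →
            1 - ε ≤ P.real {ω | |facilityCost (fun i => X i ω) - M| ≤
              L ε * (n : ℝ) ^ (1 / 3 : ℝ)}) := by
  -- Halving the exponent turns the prefactor `4` into `2`, and into `1` once `t` is large: the
  -- value of `A` is such that `A ^ 2 ≥ 2 * K`.
  refine ⟨5120, by norm_num, 102, by norm_num, fun ε => Real.sqrt (5120 * |Real.log (2 / ε)|), ?_⟩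
  intro n hn Ω _ P _ X hX hXs hind M hM
  have hn' : (1 : ℝ) ≤ n := by exact_mod_cast hn
  set z : ℝ := (n : ℝ) ^ (1 / 3 : ℝ) with hz
  have hz1 : 1 ≤ z := Real.one_le_rpow hn' (by norm_num)
  have hz2 : (n : ℝ) ^ (2 / 3 : ℝ) = z ^ 2 := by
    rw [hz, ← Real.rpow_natCast, ← Real.rpow_mul (by positivity)]; norm_num
  have hmain := fun t (ht : 0 ≤ t) =>
    measureReal_le_abs_facilityCost_sub hn hX hXs hind hM (t := t) ht
  rw [hz2] at hmain ⊢
  have hsq : ∀ t : ℝ, Real.exp (-(t ^ 2) / (2560 * z ^ 2)) =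
      Real.exp (-(t ^ 2) / (5120 * z ^ 2)) ^ 2 := by
    intro t
    rw [← Real.exp_nat_mul]
    congr 1
    push_cast
    field_simp
    ring
  simp only [hsq] at hmain
  have hfirst : ∀ t : ℝ, 0 ≤ t → P.real {ω | t ≤ |facilityCost (fun i => X i ω) - M|} ≤
      2 * Real.exp (-(t ^ 2) / (5120 * z ^ 2)) := by
    intro t ht
    have h1 := hmain t ht
    have h2 : P.real {ω | t ≤ |facilityCost (fun i => X i ω) - M|} ≤ 1 := measureReal_le_one
    have h3 := Real.exp_pos (-(t ^ 2) / (5120 * z ^ 2))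
    rcases le_total (Real.exp (-(t ^ 2) / (5120 * z ^ 2))) (1 / 2) with h | h <;> nlinarith
  refine ⟨hfirst, fun t ht => ?_, fun ε hε => ?_⟩
  · have ht0 : 0 ≤ t := le_trans (by positivity) ht
    have h1 := hmain t ht0
    have h2 : Real.exp (-(t ^ 2) / (5120 * z ^ 2)) ≤ Real.exp (-2) := by
      rw [Real.exp_le_exp, div_le_iff₀ (by positivity)]
      nlinarith [pow_le_pow_left₀ (by positivity) ht 2]
    have h3 : Real.exp (-2) ≤ 1 / 4 := by
      rw [Real.exp_neg, one_div]
      refine inv_anti₀ (by norm_num) ?_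
      have h4 := Real.add_one_le_exp (1 : ℝ)
      have h5 : Real.exp 2 = Real.exp 1 * Real.exp 1 := by rw [← Real.exp_add]; norm_num
      nlinarith
    have h4 := Real.exp_pos (-(t ^ 2) / (5120 * z ^ 2))
    nlinarith
  · set b : ℝ := Real.sqrt (5120 * |Real.log (2 / ε)|) * z with hb
    have h1 := hfirst b (by positivity)
    have h2 : Real.exp (-(b ^ 2) / (5120 * z ^ 2)) ≤ ε / 2 := by
      have e1 : -(b ^ 2) / (5120 * z ^ 2) = -|Real.log (2 / ε)| := by
        rw [hb, mul_pow, Real.sq_sqrt (by positivity)]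
        field_simp
      rw [e1, ← Real.exp_log (show 0 < ε / 2 by positivity), Real.exp_le_exp,
        show ε / 2 = (2 / ε)⁻¹ by rw [inv_div], Real.log_inv]
      exact neg_le_neg (le_abs_self _)
    have hcov : (Set.univ : Set Ω) ⊆ {ω | |facilityCost (fun i => X i ω) - M| ≤ b} ∪
        {ω | b ≤ |facilityCost (fun i => X i ω) - M|} := fun ω _ =>
      (le_total |facilityCost (fun i => X i ω) - M| b).imp id id
    have h3 := (measureReal_mono (μ := P) hcov (measure_ne_top P _)).trans
      (measureReal_union_le _ _)
    rw [probReal_univ] at h3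
    linarith
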